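/- Let $c,n\ge 1$ be integers, let $\mathcal X\subseteq\mathbb R^d$, and let $D$ be a probability distribution on $\mathcal X\times\{-1,+1\}^c$. Let $\kappa:\mathcal X\times\mathcal X\to\mathbb R$ be a (measurable) positive semidefinite symmetric kernel with $\kappa(x,x)\le r^2$ for all $x\in\mathcal X$, where $r>0$, and let $\phi:\mathcal X\to\mathbb H$ be a feature map of $\kappa$ into a Hilbert space $\mathbb H$ (for instance the reproducing kernel Hilbert space of $\kappa$), i.e. $\kappa(x,x')=\langle\phi(x),\phi(x')\rangle$. For $\Lambda\in\mathbb R$ let $$\mathcal F=\Big\{x\mapsto\big(\langle w_1,\phi(x)\rangle,\dots,\langle w_c,\phi(x)\rangle\big)\;:\;w_1,\dots,w_c\in\mathbb H,\ \Big(\sum_{j=1}^c\|w_j\|^2\Big)^{1/2}\le\Lambda\Big\}.$$ Let $\mathrm{sgn}(a)=1$ if $a>0$ and $\mathrm{sgn}(a)=-1$ otherwise. Let the base loss $\ell:\mathbb R\to\mathbb R$ be $\rho$-Lipschitz, let it dominate the 0/1 loss, i.e. $\mathbf 1[\mathrm{sgn}(a)\ne y]\le\ell(ya)$ for all $a\in\mathbb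 R$ and $y\in\{-1,+1\}$, and let it be bounded by $B$ on the margins that occur, i.e. $\ell(y f_j(x))\le B$ for all $f\in\mathcal F$, $x\in\mathcal X$, $1\le j\le c$ and $y\in\{-1,+1\}$. For $v\in\mathbb R^c$ and $y\in\{-1,+1\}^c$ let the surrogate Hamming loss be $L_h(v,y)=\frac1c\sum_{j=1}^c\ell(y_jv_j)$. Let $$R^h_{0/1}(\mathrm{sgn}\circ f)=\mathbb E_{(x,y)\sim D}\Big[\frac1c\sum_{j=1}^c\mathbf 1[\mathrm{sgn}(f_j(x))\ne y_j]\Big],\qquad \widehat R^h_S(f)=\frac1n\sum_{i=1}^nL_h(f(x_i),y_i)$$ be the 0/1 Hamming risk of the classifier $\mathrm{sgn}\circ f$ and the empirical surrogate Hamming risk of $f$ on a sample $S=((x_i,y_i))_{i=1}^n$. Then $L_h$ is $\frac{\rho}{\sqrt c}$-Lipschitz in its first argument with respect to the Euclidean norm, and the expectation defining $R^h_{0/1}(\mathrm{sgn}\circ f)$ exists for every $f\in\mathcal F$. Moreover, for every $\delta>0$, with probability at least $1-\delta$ over an i.i.d. sample $S$ of size $n$ drawn from $D$, the following bound, whose last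 two terms do not depend on $c$, holds simultaneously for all $f\in\mathcal F$: $$R^h_{0/1}(\mathrm{sgn}\circ f)\le\widehat R^h_S(f)+2\sqrt2\,\rho\sqrt{\frac{\Lambda^2r^2}{n}}+3B\sqrt{\frac{\log(2/\delta)}{2n}}.$$ -/

import Mathlib

open MeasureTheory
open scoped NNReal

noncomputable section

/-- The label set `{-1, +1}`, as a set of real numbers. -/
abbrev Label : Type := ({-1, 1} : Set ℝ)

/-- `sgn a = 1` if `a > 0`, and `sgn a = -1` otherwise. -/
def sgn (a : ℝ) : Label := if 0 < a then ⟨1, by simp⟩ else ⟨-1, by simp⟩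

/-- The classifier `sgn ∘ f` (coordinatewise) induced by a score function `f`. -/
def sgnClassifier {𝒳 : Type*} {c : ℕ} (f : 𝒳 → EuclideanSpace ℝ (Fin c)) :
    𝒳 → (Fin c → Label) :=
  fun x j => sgn (f x j)

open Classical in
/-- The indicator of a proposition, as a real number. -/
def ind (p : Prop) : ℝ := if p then 1 else 0

/-- The 0/1 Hamming loss of a predicted label vector `h` against the true label vector `y`. -/
def hammingLoss01 {c : ℕ} (h y : Fin c → Label) : ℝ :=
  (1 / (c : ℝ)) * ∑ j, ind (h j ≠ y j)

/-- The surrogate Hamming loss with base loss `ℓ`, as a function of a score vector and a label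
vector. -/
def hammingSurrogate {c : ℕ} (ℓ : ℝ → ℝ) (v : EuclideanSpace ℝ (Fin c)) (y : Fin c → Label) : ℝ :=
  (1 / (c : ℝ)) * ∑ j, ℓ ((y j : ℝ) * v j)

/-- The expected 0/1 Hamming risk of a classifier `h` under the distribution `D`. -/
def hammingRisk01 {𝒳 : Type*} [MeasurableSpace 𝒳] {c : ℕ}
    (D : Measure (𝒳 × (Fin c → Label))) (h : 𝒳 → (Fin c → Label)) : ℝ :=
  ∫ z, hammingLoss01 (h z.1) z.2 ∂D

/-- The empirical surrogate Hamming risk of a score function `f` on the sample `S`. -/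
def empiricalHammingRisk {𝒳 : Type*} {c n : ℕ} (ℓ : ℝ → ℝ)
    (S : Fin n → 𝒳 × (Fin c → Label)) (f : 𝒳 → EuclideanSpace ℝ (Fin c)) : ℝ :=
  (1 / (n : ℝ)) * ∑ i, hammingSurrogate ℓ (f (S i).1) (S i).2

/-- `κ` is a positive (semi)definite symmetric kernel. -/
def IsPSDKernel {𝒳 : Type*} (κ : 𝒳 → 𝒳 → ℝ) : Prop :=
  (Matrix.of κ).PosSemidef

/-- `φ` is a feature map of the kernel `κ` into the Hilbert space `H`. -/
def IsFeatureMap {𝒳 H : Type*} [NormedAddCommGroup H] [InnerProductSpace ℝ H]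
    (κ : 𝒳 → 𝒳 → ℝ) (φ : 𝒳 → H) : Prop :=
  ∀ x x', κ x x' = inner ℝ (φ x) (φ x')

/-- The norm `(∑ j, ‖w j‖ ^ 2) ^ (1 / 2)` of a tuple of weights in `H`. -/
def weightNorm {H : Type*} [NormedAddCommGroup H] {c : ℕ} (W : Fin c → H) : ℝ :=
  Real.sqrt (∑ j, ‖W j‖ ^ 2)

/-- The kernel-based hypothesis set: the score functions whose `j`-th coordinate is
`x ↦ ⟪w j, φ x⟫`, where the weights satisfy `weightNorm W ≤ Λ`. -/
def hypothesisSet {𝒳 H : Type*} [NormedAddCommGroup H] [InnerProductSpace ℝ H]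
    (φ : 𝒳 → H) (c : ℕ) (Λ : ℝ) : Set (𝒳 → EuclideanSpace ℝ (Fin c)) :=
  {f | ∃ W : Fin c → H, weightNorm W ≤ Λ ∧ ∀ x j, f x j = inner ℝ (W j) (φ x)}

end

/-!
The surrogate Hamming loss is the average over the labels `j` of the base loss at the `j`-th margin,
and every weight `w j` of a hypothesis has norm at most `Λ`. The supremum of an average is at most
the average of the suprema, so the uniform deviation of the risk is at most the average over `j` of
uniform deviations for the class of linear functionals with `‖w‖ ≤ Λ`. For each of these the scalar
theory gives the bound `2 ρ Λ r / √n`, which does not depend on `c`: symmetrization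
(`integral_ghostDeviation_le`), the contraction principle for the Lipschitz loss
(`sum_iSup_le_of_contraction`), and the bound `√n r` for the mean norm of a signed sum of feature
vectors (`sum_norm_boolSign_le`). Concentration is McDiarmid's inequality
(`measure_ge_le_of_bounded_differences`), obtained from Hoeffding's lemma by integrating out one
sample point at a time. The constants `2 √2` and `3 B` of the theorem leave room: `2 √2` is larger
than the `2` of symmetrization, and with `3 B` the failure probability is `(δ / 2) ^ 9 ≤ δ`.

The Hilbert space may be non-separable, even for the reproducing kernel Hilbert space of a measurable
kernel (take `κ x x' = 1` if `x = x'` and `0` otherwise), so the measurability of the supremum over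
all hypotheses of the deviation between risk and empirical risk is not clear. It is avoided as
follows. For two samples `S`, `S'` the supremum over `w` of the difference of the empirical risks
depends on `w` through finitely many scalar products only. It is therefore a supremum over rational
combinations of the feature vectors of the sample points, rescaled into the ball, and this is a
countable supremum of functions of kernel values (`measurable_iSup_closedBall_featureMap`).
Integrated over the ghost sample `S'`, it gives a measurable function of `S` that dominates the
deviation for every hypothesis (`integral_sub_mean_le_integral_ghostDeviation`). McDiarmid's
inequality is applied to this majorant, and the event of the theorem is where the majorant exceeds
its mean by less than the last term of the bound.
-/

/-! ### The bounded differences inequality -/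

lemma integrable_of_abs_le {Ω : Type*} [MeasurableSpace Ω] {μ : Measure Ω} [IsFiniteMeasure μ]
    {f : Ω → ℝ} (hf : Measurable f) {M : ℝ} (hM : ∀ ω, |f ω| ≤ M) : Integrable f μ :=
  Integrable.of_bound hf.aestronglyMeasurable M (Filter.Eventually.of_forall hM)

lemma abs_integral_le_of_abs_le {Ω : Type*} [MeasurableSpace Ω] {μ : Measure Ω}
    [IsProbabilityMeasure μ] {f : Ω → ℝ} {M : ℝ} (hM : ∀ ω, |f ω| ≤ M) : |∫ ω, f ω ∂μ| ≤ M := by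
  simpa using norm_integral_le_of_norm_le_const (μ := μ) (f := f) (C := M)
    (Filter.Eventually.of_forall hM)

/-- Fubini's theorem for a sample of size `n + 1`, split into its first point and the rest. -/
lemma integral_pi_fin_succ {Z : Type*} [MeasurableSpace Z] (D : Measure Z)
    [IsProbabilityMeasure D] {n : ℕ} {f : (Fin (n + 1) → Z) → ℝ} (hf : Measurable f) {M : ℝ}
    (hM : ∀ S, |f S| ≤ M) :
    ∫ S, f S ∂(Measure.pi fun _ => D)
      = ∫ S, ∫ z, f (Fin.cons z S) ∂D ∂(Measure.pi fun _ : Fin n => D) := by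
  have h := (measurePreserving_piFinSuccAbove (fun _ : Fin (n + 1) => D) 0).symm
  rw [← h.integral_comp']
  have hc : ∀ p : Z × (Fin n → Z),
      (MeasurableEquiv.piFinSuccAbove (fun _ : Fin (n + 1) => Z) 0).symm p = Fin.cons p.1 p.2 := by
    intro p
    simp [MeasurableEquiv.piFinSuccAbove, Fin.insertNthEquiv]
  have hint : Integrable (fun p => f ((MeasurableEquiv.piFinSuccAbove
      (fun _ : Fin (n + 1) => Z) 0).symm p)) (D.prod (Measure.pi fun _ : Fin n => D)) :=
    integrable_of_abs_le (hf.comp h.measurable) (fun p => hM _)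
  rw [integral_prod_symm _ hint]
  simp only [hc]

lemma measurable_fin_cons {Z : Type*} [MeasurableSpace Z] {n : ℕ} :
    Measurable (fun p : Z × (Fin n → Z) => (Fin.cons p.1 p.2 : Fin (n + 1) → Z)) := by
  refine measurable_pi_iff.2 fun k => ?_
  refine Fin.cases ?_ (fun k => ?_) k
  · simpa using measurable_fst
  · simpa [Function.comp_def] using (measurable_pi_apply k).comp measurable_snd

/-- Hoeffding's lemma for a function whose oscillation is at most `b`. -/
lemma integral_exp_le_of_oscillation_le {Z : Type*} [MeasurableSpace Z] (D : Measure Z)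
    [IsProbabilityMeasure D] {f : Z → ℝ} (hf : Measurable f) {M b : ℝ} (hM : ∀ z, |f z| ≤ M)
    (hb : 0 ≤ b) (hosc : ∀ z z', f z - f z' ≤ b) (t : ℝ) :
    ∫ z, Real.exp (t * (f z - ∫ z', f z' ∂D)) ∂D ≤ Real.exp ((b / 2) ^ 2 * t ^ 2 / 2) := by
  have : Nonempty Z := nonempty_of_isProbabilityMeasure D
  have hbdd : BddBelow (Set.range f) := ⟨-M, by rintro _ ⟨z, rfl⟩; exact (abs_le.1 (hM z)).1⟩
  have hmem : ∀ᵐ z ∂D, f z ∈ Set.Icc (⨅ z, f z) ((⨅ z, f z) + b) := by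
    refine Filter.Eventually.of_forall fun z => ⟨ciInf_le hbdd z, ?_⟩
    have : f z - b ≤ ⨅ z, f z := le_ciInf fun z' => by linarith [hosc z z']
    linarith
  have h := (ProbabilityTheory.hasSubgaussianMGF_of_mem_Icc hf.aemeasurable hmem).mgf_le t
  have hcoe : (((‖(⨅ z, f z) + b - ⨅ z, f z‖₊ / 2) ^ 2 : ℝ≥0) : ℝ) = (b / 2) ^ 2 := by
    simp [abs_of_nonneg hb]
  rwa [hcoe] at h

/-- The exponential moment bound behind McDiarmid's inequality. -/
lemma integral_exp_le_of_bounded_differences {Z : Type*} [MeasurableSpace Z] (D : Measure Z)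
    [IsProbabilityMeasure D] {b : ℝ} (hb : 0 ≤ b) (t : ℝ) {n : ℕ} {g : (Fin n → Z) → ℝ}
    (hg : Measurable g) {M : ℝ} (hM : ∀ S, |g S| ≤ M)
    (hdiff : ∀ S k z, |g (Function.update S k z) - g S| ≤ b) :
    ∫ S, Real.exp (t * (g S - ∫ S', g S' ∂(Measure.pi fun _ => D))) ∂(Measure.pi fun _ => D)
      ≤ Real.exp (n * ((b / 2) ^ 2 * t ^ 2 / 2)) := by
  induction n with
  | zero =>
    have : ∀ S, g S = g default := fun S => congrArg g (Subsingleton.elim _ _)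
    simp [this]
  | succ n ih =>
    set P := Measure.pi (fun _ : Fin n => D) with hP
    -- Averaging out the first coordinate preserves the bounded differences property.
    set h : (Fin n → Z) → ℝ := fun S => ∫ z, g (Fin.cons z S) ∂D with hh
    have hgc : Measurable (fun p : Z × (Fin n → Z) => g (Fin.cons p.1 p.2)) :=
      hg.comp measurable_fin_cons
    have hgS : ∀ S : Fin n → Z, Measurable (fun z => g (Fin.cons z S)) := fun S =>
      hgc.comp (measurable_id.prodMk measurable_const)
    have hh_meas : Measurable h :=
      (hgc.stronglyMeasurable.integral_prod_left' (μ := D)).measurable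
    have hhM : ∀ S, |h S| ≤ M := fun S => abs_integral_le_of_abs_le fun z => hM _
    have hh_diff : ∀ S k z, |h (Function.update S k z) - h S| ≤ b := by
      intro S k z
      simp only [hh]
      rw [← integral_sub (integrable_of_abs_le (hgS _) fun z => hM _)
        (integrable_of_abs_le (hgS _) fun z => hM _)]
      refine abs_integral_le_of_abs_le fun z' => ?_
      rw [Fin.cons_update]
      exact hdiff _ _ _
    have hmean : ∫ S, g S ∂(Measure.pi fun _ => D) = ∫ S, h S ∂P :=
      integral_pi_fin_succ D hg hM
    set m := ∫ S, h S ∂P with hm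
    have hmM : |m| ≤ M := abs_integral_le_of_abs_le hhM
    have hexpM : ∀ x : ℝ, |x| ≤ M → |Real.exp (t * (x - m))| ≤ Real.exp (|t| * (M + M)) := by
      intro x hx
      rw [abs_of_pos (Real.exp_pos _), Real.exp_le_exp]
      calc t * (x - m) ≤ |t| * |x - m| := by rw [← abs_mul]; exact le_abs_self _
        _ ≤ |t| * (M + M) := by
          gcongr
          exact (abs_sub _ _).trans (add_le_add hx hmM)
    rw [hmean, integral_pi_fin_succ D (by fun_prop) (fun S => hexpM _ (hM S))]
    have hinner : ∀ S : Fin n → Z, ∫ z, Real.exp (t * (g (Fin.cons z S) - m)) ∂D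
        ≤ Real.exp ((b / 2) ^ 2 * t ^ 2 / 2) * Real.exp (t * (h S - m)) := by
      intro S
      have hsplit : ∀ z, Real.exp (t * (g (Fin.cons z S) - m))
          = Real.exp (t * (g (Fin.cons z S) - h S)) * Real.exp (t * (h S - m)) := by
        intro z
        rw [← Real.exp_add]
        ring_nf
      simp only [hsplit]
      rw [integral_mul_const]
      gcongr
      refine integral_exp_le_of_oscillation_le D (hgS S) (fun z => hM _) hb (fun z z' => ?_) t
      have := hdiff (Fin.cons z' S) 0 z
      rw [Fin.update_cons_zero] at this
      exact (le_abs_self _).trans this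
    have hint : Integrable (fun S => Real.exp (t * (h S - m))) P :=
      integrable_of_abs_le (by fun_prop) (fun S => hexpM _ (hhM S))
    calc ∫ S, ∫ z, Real.exp (t * (g (Fin.cons z S) - m)) ∂D ∂P
        ≤ ∫ S, Real.exp ((b / 2) ^ 2 * t ^ 2 / 2) * Real.exp (t * (h S - m)) ∂P :=
          integral_mono_of_nonneg
            (Filter.Eventually.of_forall fun S => integral_nonneg fun z => (Real.exp_pos _).le)
            (hint.const_mul _) (Filter.Eventually.of_forall hinner)
      _ = Real.exp ((b / 2) ^ 2 * t ^ 2 / 2) * ∫ S, Real.exp (t * (h S - m)) ∂P :=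
          integral_const_mul _ _
      _ ≤ Real.exp ((b / 2) ^ 2 * t ^ 2 / 2) * Real.exp (n * ((b / 2) ^ 2 * t ^ 2 / 2)) := by
          gcongr
          exact ih hh_meas hhM hh_diff
      _ = Real.exp ((n + 1 : ℕ) * ((b / 2) ^ 2 * t ^ 2 / 2)) := by
          rw [← Real.exp_add]
          push_cast
          ring_nf

/-- **McDiarmid's inequality** for an i.i.d. sample and equal bounds on the differences. -/
lemma measure_ge_le_of_bounded_differences {Z : Type*} [MeasurableSpace Z] (D : Measure Z)
    [IsProbabilityMeasure D] {n : ℕ} (hn : 0 < n) {b : ℝ} (hb : 0 < b) {g : (Fin n → Z) → ℝ}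
    (hg : Measurable g) {M : ℝ} (hM : ∀ S, |g S| ≤ M)
    (hdiff : ∀ S k z, |g (Function.update S k z) - g S| ≤ b) {ε : ℝ} (hε : 0 ≤ ε) :
    (Measure.pi fun _ : Fin n => D).real
        {S | ε ≤ g S - ∫ S', g S' ∂(Measure.pi fun _ => D)}
      ≤ Real.exp (-(2 * ε ^ 2 / (n * b ^ 2))) := by
  have hn' : (0 : ℝ) < n := by exact_mod_cast hn
  set P := Measure.pi (fun _ : Fin n => D) with hP
  set m := ∫ S', g S' ∂P with hm
  -- The optimal Chernoff parameter.
  set t : ℝ := 4 * ε / (n * b ^ 2) with ht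
  have ht0 : 0 ≤ t := by positivity
  have hmM : |m| ≤ M := abs_integral_le_of_abs_le hM
  have hint : Integrable (fun S => Real.exp (t * (g S - m))) P := by
    refine integrable_of_abs_le (by fun_prop) (M := Real.exp (t * (M + M))) fun S => ?_
    rw [abs_of_pos (Real.exp_pos _), Real.exp_le_exp]
    gcongr
    exact (le_abs_self _).trans ((abs_sub _ _).trans (add_le_add (hM S) hmM))
  refine (ProbabilityTheory.measure_ge_le_exp_mul_mgf ε ht0 hint).trans ?_
  refine (mul_le_mul_of_nonneg_left
    (integral_exp_le_of_bounded_differences D hb.le t hg hM hdiff) (Real.exp_pos _).le).trans ?_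
  rw [← Real.exp_add, Real.exp_le_exp, ht]
  apply le_of_eq
  field_simp
  ring

/-! ### Rademacher averages: contraction and balls of a Hilbert space -/

/-- The random sign `+1` or `-1` encoded by a Boolean. -/
def boolSign (s : Bool) : ℝ := if s then 1 else -1

@[simp] lemma boolSign_true : boolSign true = 1 := rfl

@[simp] lemma boolSign_false : boolSign false = -1 := rfl

lemma abs_boolSign (s : Bool) : |boolSign s| = 1 := by cases s <;> simp

lemma bddAbove_range_of_abs_le {ι : Type*} {f : ι → ℝ} {M : ℝ} (h : ∀ i, |f i| ≤ M) :
    BddAbove (Set.range f) :=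
  ⟨M, by rintro _ ⟨i, rfl⟩; exact (le_abs_self _).trans (h i)⟩

lemma abs_sum_le_sum_of_abs_le {α : Type*} {s : Finset α} {f M : α → ℝ}
    (h : ∀ k ∈ s, |f k| ≤ M k) : |∑ k ∈ s, f k| ≤ ∑ k ∈ s, M k :=
  (Finset.abs_sum_le_sum_abs _ _).trans (Finset.sum_le_sum h)

lemma abs_sum_boolSign_mul_le {n : ℕ} (σ : Fin n → Bool) {v M : Fin n → ℝ}
    (h : ∀ k, |v k| ≤ M k) : |∑ k, boolSign (σ k) * v k| ≤ ∑ k, M k :=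
  abs_sum_le_sum_of_abs_le fun k _ => by rw [abs_mul, abs_boolSign, one_mul]; exact h k

lemma sum_fin_succ_bool {n : ℕ} (F : (Fin (n + 1) → Bool) → ℝ) :
    ∑ σ, F σ = ∑ σ : Fin n → Bool, (F (Fin.cons true σ) + F (Fin.cons false σ)) := by
  rw [← (Fin.consEquiv (fun _ : Fin (n + 1) => Bool)).sum_comp, Fintype.sum_prod_type,
    Fintype.sum_bool, ← Finset.sum_add_distrib]
  rfl

/-- One step of the contraction principle: two parameters `i`, `i'` chosen separately for the two
signs can be exchanged, so only the distance of `v i` and `v i'` counts. -/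
lemma iSup_add_iSup_sub_le {ι : Type*} [Nonempty ι] {A u v : ι → ℝ} {MA Mu : ℝ}
    (hA : ∀ i, |A i| ≤ MA) (hu : ∀ i, |u i| ≤ Mu)
    (huv : ∀ i i', |v i - v i'| ≤ |u i - u i'|) :
    (⨆ i, (A i + v i)) + (⨆ i, (A i - v i)) ≤ (⨆ i, (A i + u i)) + (⨆ i, (A i - u i)) := by
  have h1 : BddAbove (Set.range fun i => A i + u i) :=
    bddAbove_range_of_abs_le fun i => (abs_add_le _ _).trans (add_le_add (hA i) (hu i))
  have h2 : BddAbove (Set.range fun i => A i - u i) :=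
    bddAbove_range_of_abs_le fun i => (abs_sub _ _).trans (add_le_add (hA i) (hu i))
  rw [← le_sub_iff_add_le]
  refine ciSup_le fun i => ?_
  rw [le_sub_comm]
  refine ciSup_le fun i' => ?_
  have hv := (le_abs_self _).trans (huv i i')
  have a1 := le_ciSup h1 i
  have a2 := le_ciSup h2 i
  have b1 := le_ciSup h1 i'
  have b2 := le_ciSup h2 i'
  rcases abs_cases (u i - u i') with ⟨h, _⟩ | ⟨h, _⟩ <;> rw [h] at hv <;> linarith

/-- **Talagrand's contraction principle** for Rademacher averages, without normalization. The term
`A` carries the coordinates already treated in the induction. -/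
lemma sum_iSup_le_of_contraction {ι : Type*} [Nonempty ι] {n : ℕ} {A : ι → ℝ} {MA : ℝ}
    (hA : ∀ i, |A i| ≤ MA) {u v : Fin n → ι → ℝ} {Mu Mv : Fin n → ℝ}
    (hu : ∀ k i, |u k i| ≤ Mu k) (hv : ∀ k i, |v k i| ≤ Mv k)
    (huv : ∀ k i i', |v k i - v k i'| ≤ |u k i - u k i'|) :
    ∑ σ : Fin n → Bool, ⨆ i, (A i + ∑ k, boolSign (σ k) * v k i)
      ≤ ∑ σ : Fin n → Bool, ⨆ i, (A i + ∑ k, boolSign (σ k) * u k i) := by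
  induction n generalizing A MA with
  | zero => simp
  | succ n ih =>
    have hstep : ∀ σ : Fin n → Bool,
        (⨆ i, (A i + ∑ k, boolSign ((Fin.cons true σ : Fin (n + 1) → Bool) k) * v k i))
          + (⨆ i, (A i + ∑ k, boolSign ((Fin.cons false σ : Fin (n + 1) → Bool) k) * v k i))
        ≤ (⨆ i, ((A i + u 0 i) + ∑ k, boolSign (σ k) * v k.succ i))
          + (⨆ i, ((A i - u 0 i) + ∑ k, boolSign (σ k) * v k.succ i)) := by
      intro σ
      have h := iSup_add_iSup_sub_le (A := fun i => A i + ∑ k, boolSign (σ k) * v k.succ i)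
        (u := u 0) (v := v 0) (MA := MA + ∑ k : Fin n, Mv k.succ)
        (fun i => (abs_add_le _ _).trans (add_le_add (hA i)
          (abs_sum_boolSign_mul_le σ fun k => hv k.succ i))) (hu 0) (huv 0)
      refine (le_of_eq ?_).trans (h.trans (le_of_eq ?_)) <;> congr 1 <;>
        refine iSup_congr fun i => ?_
      · simp [Fin.sum_univ_succ]
        ring
      · simp [Fin.sum_univ_succ]
        ring
      all_goals ring
    have hplus := ih (A := fun i => A i + u 0 i)
      (fun i => (abs_add_le _ _).trans (add_le_add (hA i) (hu 0 i)))
      (fun k => hu k.succ) (fun k => hv k.succ) (fun k => huv k.succ)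
    have hminus := ih (A := fun i => A i - u 0 i)
      (fun i => (abs_sub _ _).trans (add_le_add (hA i) (hu 0 i)))
      (fun k => hu k.succ) (fun k => hv k.succ) (fun k => huv k.succ)
    rw [sum_fin_succ_bool, sum_fin_succ_bool]
    refine (Finset.sum_le_sum fun σ _ => hstep σ).trans ?_
    rw [Finset.sum_add_distrib, Finset.sum_add_distrib]
    refine (add_le_add hplus hminus).trans (le_of_eq ?_)
    congr 1 <;> refine Finset.sum_congr rfl fun σ _ => iSup_congr fun i => ?_ <;>
      simp [Fin.sum_univ_succ] <;> ring

section SignedSums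

variable {H : Type*} [NormedAddCommGroup H] [InnerProductSpace ℝ H]

/-- Random signs make vectors orthogonal on average; this is the parallelogram law, iterated. -/
lemma sum_norm_sq_boolSign {n : ℕ} (a : H) (x : Fin n → H) :
    ∑ σ : Fin n → Bool, ‖a + ∑ k, boolSign (σ k) • x k‖ ^ 2
      = 2 ^ n * (‖a‖ ^ 2 + ∑ k, ‖x k‖ ^ 2) := by
  induction n generalizing a with
  | zero => simp
  | succ n ih =>
    rw [sum_fin_succ_bool, Finset.sum_add_distrib]
    have h1 := ih (a + x 0) (fun k => x k.succ)
    have h2 := ih (a - x 0) (fun k => x k.succ)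
    have hp := parallelogram_law_with_norm ℝ a (x 0)
    simp only [Fin.sum_univ_succ, Fin.cons_zero, Fin.cons_succ, boolSign_true, boolSign_false,
      one_smul, neg_smul, ← add_assoc, ← sub_eq_add_neg] at h1 h2 ⊢
    rw [h1, h2, pow_succ]
    linear_combination (2 : ℝ) ^ n * hp

lemma sum_norm_boolSign_le {n : ℕ} (x : Fin n → H) :
    ∑ σ : Fin n → Bool, ‖∑ k, boolSign (σ k) • x k‖ ≤ 2 ^ n * √(∑ k, ‖x k‖ ^ 2) := by
  have hcs := sq_sum_le_card_mul_sum_sq (s := Finset.univ)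
    (f := fun σ : Fin n → Bool => ‖∑ k, boolSign (σ k) • x k‖)
  have h := sum_norm_sq_boolSign 0 x
  simp only [zero_add, norm_zero, ne_eq, OfNat.ofNat_ne_zero, not_false_eq_true, zero_pow] at h
  rw [h] at hcs
  have hcard : ((Finset.univ : Finset (Fin n → Bool)).card : ℝ) = 2 ^ n := by simp
  rw [hcard] at hcs
  refine abs_le_of_sq_le_sq' ?_ (by positivity) |>.2
  rw [mul_pow, Real.sq_sqrt (by positivity)]
  linarith

/-- The Rademacher average of a `ρ`-Lipschitz loss of linear functionals of norm at most `Λ`: the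
contraction principle reduces it to the dual norm of a signed sum. -/
lemma sum_iSup_lipschitz_inner_le {n : ℕ} {Λ : ℝ} (hΛ : 0 ≤ Λ) {ρ : ℝ≥0} {g : Fin n → ℝ → ℝ}
    (hg : ∀ k, LipschitzWith ρ (g k)) {Mg : ℝ} {x : Fin n → H}
    (hgM : ∀ k (w : Metric.closedBall (0 : H) Λ), |g k (inner ℝ (w : H) (x k))| ≤ Mg) :
    ∑ σ : Fin n → Bool, ⨆ w : Metric.closedBall (0 : H) Λ,
        ∑ k, boolSign (σ k) * g k (inner ℝ (w : H) (x k))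
      ≤ 2 ^ n * (ρ * Λ * √(∑ k, ‖x k‖ ^ 2)) := by
  have : Nonempty (Metric.closedBall (0 : H) Λ) := ⟨⟨0, by simpa using hΛ⟩⟩
  have hw : ∀ w : Metric.closedBall (0 : H) Λ, ‖(w : H)‖ ≤ Λ := fun w =>
    mem_closedBall_zero_iff.1 w.2
  have hcontr := sum_iSup_le_of_contraction (A := fun _ : Metric.closedBall (0 : H) Λ => 0)
    (MA := 0) (by simp) (u := fun k w => ρ * inner ℝ (w : H) (x k))
    (v := fun k w => g k (inner ℝ (w : H) (x k))) (Mu := fun k => ρ * (Λ * ‖x k‖))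
    (Mv := fun _ => Mg)
    (fun k w => by
      rw [abs_mul, NNReal.abs_eq]
      gcongr
      exact (abs_real_inner_le_norm _ _).trans (by gcongr; exact hw w))
    hgM
    (fun k w w' => by
      rw [← mul_sub, abs_mul, NNReal.abs_eq]
      simpa [Real.dist_eq] using (hg k).dist_le_mul (inner ℝ (w : H) (x k)) (inner ℝ (w' : H) (x k)))
  simp only [zero_add] at hcontr
  refine hcontr.trans ?_
  calc ∑ σ : Fin n → Bool, ⨆ w : Metric.closedBall (0 : H) Λ,
          ∑ k, boolSign (σ k) * (ρ * inner ℝ (w : H) (x k))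
      ≤ ∑ σ : Fin n → Bool, ρ * Λ * ‖∑ k, boolSign (σ k) • x k‖ := by
        refine Finset.sum_le_sum fun σ _ => ciSup_le fun w => ?_
        have : ∑ k, boolSign (σ k) * (ρ * inner ℝ (w : H) (x k))
            = ρ * inner ℝ (w : H) (∑ k, boolSign (σ k) • x k) := by
          rw [inner_sum, Finset.mul_sum]
          refine Finset.sum_congr rfl fun k _ => ?_
          rw [real_inner_smul_right]
          ring
        rw [this, mul_assoc]
        gcongr
        exact (real_inner_le_norm _ _).trans (by gcongr; exact hw w)
    _ = ρ * Λ * ∑ σ : Fin n → Bool, ‖∑ k, boolSign (σ k) • x k‖ := by rw [Finset.mul_sum]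
    _ ≤ ρ * Λ * (2 ^ n * √(∑ k, ‖x k‖ ^ 2)) := by
        gcongr
        exact sum_norm_boolSign_le x
    _ = 2 ^ n * (ρ * Λ * √(∑ k, ‖x k‖ ^ 2)) := by ring

end SignedSums

/-! ### Symmetrization with a ghost sample -/

section Symmetrization

variable {Z ι : Type*} {n : ℕ} {h : ι → Z → ℝ} {B : ℝ}

/-- The largest amount by which the average of some `h i` on the sample `S'` exceeds its average
on the sample `S`. -/
noncomputable def ghostDeviation (h : ι → Z → ℝ) (S S' : Fin n → Z) : ℝ :=
  ⨆ i, (1 / (n : ℝ)) * ∑ k, (h i (S' k) - h i (S k))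

lemma abs_ghostDeviation_term_le (hh : ∀ i z, h i z ∈ Set.Icc 0 B) (S S' : Fin n → Z) (i : ι) :
    |(1 / (n : ℝ)) * ∑ k, (h i (S' k) - h i (S k))| ≤ (1 / (n : ℝ)) * (n * B) := by
  rw [abs_mul, abs_of_nonneg (by positivity : (0 : ℝ) ≤ 1 / n)]
  gcongr
  refine (abs_sum_le_sum_of_abs_le (M := fun _ => B) fun k _ => ?_).trans (by simp)
  have h1 := hh i (S' k)
  have h2 := hh i (S k)
  exact abs_le.2 ⟨by linarith [h1.1, h2.2], by linarith [h1.2, h2.1]⟩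

lemma bddAbove_ghostDeviation (hh : ∀ i z, h i z ∈ Set.Icc 0 B) (S S' : Fin n → Z) :
    BddAbove (Set.range fun i => (1 / (n : ℝ)) * ∑ k, (h i (S' k) - h i (S k))) :=
  bddAbove_range_of_abs_le (abs_ghostDeviation_term_le hh S S')

lemma abs_ghostDeviation_le [Nonempty ι] (hh : ∀ i z, h i z ∈ Set.Icc 0 B) (S S' : Fin n → Z) :
    |ghostDeviation h S S'| ≤ (1 / (n : ℝ)) * (n * B) := by
  have i₀ : ι := Classical.arbitrary ι
  refine abs_le.2 ⟨?_, ciSup_le fun i => (abs_le.1 (abs_ghostDeviation_term_le hh S S' i)).2⟩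
  exact (abs_le.1 (abs_ghostDeviation_term_le hh S S' i₀)).1.trans
    (le_ciSup (bddAbove_ghostDeviation hh S S') i₀)

lemma ghostDeviation_update_le [Nonempty ι] (hh : ∀ i z, h i z ∈ Set.Icc 0 B)
    (S S' : Fin n → Z) (k : Fin n) (z z' : Z) :
    ghostDeviation h (Function.update S k z) S'
      ≤ ghostDeviation h (Function.update S k z') S' + B / n := by
  refine ciSup_le fun i => ?_
  have hle := le_ciSup (bddAbove_ghostDeviation hh (Function.update S k z') S') i
  have hsum : ∀ y, ∑ j, (h i (S' j) - h i (Function.update S k y j))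
      = ∑ j, h i (S' j) - (h i y + ∑ j ∈ Finset.univ \ {k}, h i (S j)) := by
    intro y
    rw [Finset.sum_sub_distrib]
    congr 1
    have := Finset.sum_update_of_mem (Finset.mem_univ k) (fun j => h i (S j)) (h i y)
    rw [← this]
    refine Finset.sum_congr rfl fun j _ => ?_
    by_cases hj : j = k
    · subst hj; simp
    · simp [hj]
  rw [hsum] at hle ⊢
  refine le_trans ?_ (add_le_add_left hle _)
  have h1 := (hh i z).1
  have h2 := (hh i z').2
  have : (0 : ℝ) ≤ (1 / n) * (B + h i z - h i z') := by
    have : 0 ≤ B + h i z - h i z' := by linarith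
    positivity
  have hBn : B / n = (1 / n) * B := by ring
  rw [hBn]
  linarith

lemma abs_ghostDeviation_update_sub_le [Nonempty ι] (hh : ∀ i z, h i z ∈ Set.Icc 0 B)
    (S S' : Fin n → Z) (k : Fin n) (z : Z) :
    |ghostDeviation h (Function.update S k z) S' - ghostDeviation h S S'| ≤ B / n := by
  have h1 := ghostDeviation_update_le hh S S' k z (S k)
  have h2 := ghostDeviation_update_le hh S S' k (S k) z
  rw [Function.update_eq_self] at h1 h2
  exact abs_sub_le_iff.2 ⟨by linarith, by linarith⟩

/-- Averaged over all exchanges of points between the two samples, the deviation is at most twice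
the (unnormalized) Rademacher average `R`. -/
lemma sum_ghostDeviation_swap_le [Nonempty ι] (hh : ∀ i z, h i z ∈ Set.Icc 0 B) {R : ℝ}
    (hR : ∀ S : Fin n → Z, ∑ σ : Fin n → Bool, ⨆ i, ∑ k, boolSign (σ k) * h i (S k) ≤ 2 ^ n * R)
    (p : Fin n → Z × Z) :
    ∑ σ : Fin n → Bool, ghostDeviation h
        (fun k => (if σ k then p k else (p k).swap).1)
        (fun k => (if σ k then p k else (p k).swap).2)
      ≤ 2 ^ n * (2 * R / n) := by
  have hbdd : ∀ (σ : Fin n → Bool) (S : Fin n → Z),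
      BddAbove (Set.range fun i => ∑ k, boolSign (σ k) * h i (S k)) := fun σ S =>
    bddAbove_range_of_abs_le fun i => abs_sum_boolSign_mul_le σ (M := fun _ => B) fun k =>
      abs_le.2 ⟨by linarith [(hh i (S k)).1, (hh i (S k)).2], (hh i (S k)).2⟩
  have hterm : ∀ σ : Fin n → Bool, ghostDeviation h
        (fun k => (if σ k then p k else (p k).swap).1)
        (fun k => (if σ k then p k else (p k).swap).2)
      ≤ (1 / (n : ℝ)) * ((⨆ i, ∑ k, boolSign (σ k) * h i (p k).2)
        + ⨆ i, ∑ k, boolSign (!σ k) * h i (p k).1) := by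
    intro σ
    refine ciSup_le fun i => ?_
    gcongr
    refine le_trans (le_of_eq ?_) (add_le_add (le_ciSup (hbdd σ fun k => (p k).2) i)
      (le_ciSup (hbdd (fun k => !σ k) fun k => (p k).1) i))
    simp only
    rw [← Finset.sum_add_distrib]
    refine Finset.sum_congr rfl fun k _ => ?_
    cases σ k <;> simp <;> ring
  have hnot : ∑ σ : Fin n → Bool, ⨆ i, ∑ k, boolSign (!σ k) * h i (p k).1
      = ∑ σ : Fin n → Bool, ⨆ i, ∑ k, boolSign (σ k) * h i (p k).1 :=
    (Equiv.arrowCongr (Equiv.refl (Fin n)) Equiv.boolNot).sum_comp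
      (fun σ : Fin n → Bool => ⨆ i, ∑ k, boolSign (σ k) * h i (p k).1)
  refine (Finset.sum_le_sum fun σ _ => hterm σ).trans ?_
  rw [← Finset.mul_sum, Finset.sum_add_distrib, hnot]
  calc (1 / (n : ℝ)) * _ ≤ (1 / (n : ℝ)) * (2 ^ n * R + 2 ^ n * R) := by
        gcongr
        · exact hR fun k => (p k).2
        · exact hR fun k => (p k).1
    _ = 2 ^ n * (2 * R / n) := by ring

variable [MeasurableSpace Z] (D : Measure Z) [IsProbabilityMeasure D]

/-- **Symmetrization**: exchanging points between two independent samples preserves their joint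
law, so the mean deviation is bounded by the average over all exchanges. -/
lemma integral_ghostDeviation_le [Nonempty ι] (hh : ∀ i z, h i z ∈ Set.Icc 0 B)
    (hmeas : Measurable fun p : (Fin n → Z) × (Fin n → Z) => ghostDeviation h p.1 p.2) {R : ℝ}
    (hR : ∀ S : Fin n → Z, ∑ σ : Fin n → Bool, ⨆ i, ∑ k, boolSign (σ k) * h i (S k) ≤ 2 ^ n * R) :
    ∫ S : Fin n → Z, ∫ S', ghostDeviation h S S' ∂(Measure.pi fun _ => D) ∂(Measure.pi fun _ => D)
      ≤ 2 * R / n := by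
  set P := Measure.pi (fun _ : Fin n => D) with hP
  set Q := Measure.pi (fun _ : Fin n => D.prod D) with hQ
  have hint : Integrable (fun p : (Fin n → Z) × (Fin n → Z) => ghostDeviation h p.1 p.2)
      (P.prod P) := integrable_of_abs_le hmeas fun p => abs_ghostDeviation_le hh p.1 p.2
  have hmp : MeasurePreserving
      (fun q : Fin n → Z × Z => ((fun k => (q k).1, fun k => (q k).2) : (Fin n → Z) × (Fin n → Z)))
      Q (P.prod P) :=
    measurePreserving_arrowProdEquivProdArrow Z Z (Fin n) (fun _ => D) (fun _ => D)
  set F : (Fin n → Z × Z) → ℝ :=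
    fun q => ghostDeviation h (fun k => (q k).1) (fun k => (q k).2) with hF
  have hFmeas : Measurable F := by
    have := hmeas.comp hmp.measurable
    exact this
  have hFint : Integrable F Q :=
    integrable_of_abs_le hFmeas fun q => abs_ghostDeviation_le hh _ _
  have h1 : ∫ S, ∫ S', ghostDeviation h S S' ∂P ∂P = ∫ q, F q ∂Q := by
    rw [← integral_prod _ hint]
    rw [← hmp.map_eq, integral_map hmp.measurable.aemeasurable hmeas.aestronglyMeasurable]
  have hswap : ∀ σ : Fin n → Bool,
      MeasurePreserving (fun (q : Fin n → Z × Z) k => if σ k then q k else (q k).swap) Q Q := by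
    intro σ
    refine measurePreserving_pi (f := fun k (z : Z × Z) => if σ k then z else z.swap) _ _
      fun k => ?_
    cases σ k
    · simpa using Measure.measurePreserving_swap (μ := D) (ν := D)
    · exact MeasurePreserving.id (D.prod D)
  have h2 : ∀ σ : Fin n → Bool,
      ∫ q, F (fun k => if σ k then q k else (q k).swap) ∂Q = ∫ q, F q ∂Q := by
    intro σ
    have := integral_map (μ := Q) (hswap σ).measurable.aemeasurable
      (f := F) hFmeas.aestronglyMeasurable
    rw [(hswap σ).map_eq] at this
    exact this.symm
  have hFσ : ∀ σ : Fin n → Bool,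
      Integrable (fun q => F (fun k => if σ k then q k else (q k).swap)) Q :=
    fun σ => (hswap σ).integrable_comp_of_integrable hFint
  have h3 : (2 : ℝ) ^ n * ∫ q, F q ∂Q
      = ∫ q, ∑ σ : Fin n → Bool, F (fun k => if σ k then q k else (q k).swap) ∂Q := by
    rw [integral_finsetSum _ fun σ _ => hFσ σ]
    simp [h2]
  have h4 : (2 : ℝ) ^ n * ∫ q, F q ∂Q ≤ 2 ^ n * (2 * R / n) := by
    rw [h3]
    calc ∫ q, ∑ σ : Fin n → Bool, F (fun k => if σ k then q k else (q k).swap) ∂Q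
        ≤ ∫ _q, (2 ^ n * (2 * R / n) : ℝ) ∂Q :=
          integral_mono
            (integrable_finsetSum _ fun σ _ => hFσ σ)
            (integrable_const _) fun q => sum_ghostDeviation_swap_le hh hR q
      _ = 2 ^ n * (2 * R / n) := by simp
  rw [h1]
  exact le_of_mul_le_mul_left h4 (by positivity)

/-- Averaging over the ghost sample dominates the deviation of every empirical mean from its
expectation. -/
lemma integral_sub_mean_le_integral_ghostDeviation (hn : 0 < n)
    (hh : ∀ i z, h i z ∈ Set.Icc 0 B)
    (hhm : ∀ i, Measurable (h i))
    (hmeas : Measurable fun p : (Fin n → Z) × (Fin n → Z) => ghostDeviation h p.1 p.2)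
    (S : Fin n → Z) (i : ι) :
    ∫ z, h i z ∂D - (1 / (n : ℝ)) * ∑ k, h i (S k)
      ≤ ∫ S', ghostDeviation h S S' ∂(Measure.pi fun _ => D) := by
  have : Nonempty ι := ⟨i⟩
  have hn' : (n : ℝ) ≠ 0 := by positivity
  set P := Measure.pi (fun _ : Fin n => D) with hP
  have hk : ∀ k : Fin n, Integrable (fun S' : Fin n → Z => h i (S' k) - h i (S k)) P := fun k =>
    integrable_of_abs_le (((hhm i).comp (measurable_pi_apply k)).sub_const _) (M := B)
      fun S' => by
        have h1 := hh i (S' k)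
        have h2 := hh i (S k)
        exact abs_le.2 ⟨by linarith [h1.1, h2.2], by linarith [h1.2, h2.1]⟩
  have hint : ∀ k : Fin n, ∫ S', (h i (S' k) - h i (S k)) ∂P = ∫ z, h i z ∂D - h i (S k) := by
    intro k
    have h1 : Integrable (fun S' : Fin n → Z => h i (S' k)) P :=
      integrable_of_abs_le ((hhm i).comp (measurable_pi_apply k)) (M := B)
        fun S' => abs_le.2 ⟨by linarith [(hh i (S' k)).1, (hh i (S' k)).2], (hh i (S' k)).2⟩
    rw [integral_sub h1 (integrable_const _),
      integral_comp_eval (μ := fun _ : Fin n => D) (hhm i).aestronglyMeasurable]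
    simp
  calc ∫ z, h i z ∂D - (1 / (n : ℝ)) * ∑ k, h i (S k)
      = ∫ S', (1 / (n : ℝ)) * ∑ k, (h i (S' k) - h i (S k)) ∂P := by
        rw [integral_const_mul, integral_finsetSum _ fun k _ => hk k]
        simp only [hint, Finset.sum_sub_distrib, Finset.sum_const, Finset.card_univ,
          Fintype.card_fin, nsmul_eq_mul]
        field_simp
    _ ≤ ∫ S', ghostDeviation h S S' ∂P := by
        have hS : Measurable fun S' : Fin n → Z => ghostDeviation h S S' := by
          have := hmeas.comp (measurable_prodMk_left (x := S))
          exact this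
        refine integral_mono ((integrable_finsetSum _ fun k _ => hk k).const_mul _)
          (integrable_of_abs_le hS fun S' => abs_ghostDeviation_le hh S S') fun S' => ?_
        exact le_ciSup (bddAbove_ghostDeviation hh S S') i

end Symmetrization

/-! ### Measurability over a possibly non-separable Hilbert space -/

section Measurability

variable {𝒳 H : Type*} [MeasurableSpace 𝒳] [NormedAddCommGroup H] [InnerProductSpace ℝ H]
  {κ : 𝒳 → 𝒳 → ℝ} {φ : 𝒳 → H}

/-- Linear functionals of a feature map of a measurable kernel are measurable. The vectors `w` for
which this holds form a closed subspace that contains all `φ x`, and also everything orthogonal to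
it. -/
lemma measurable_inner_featureMap [CompleteSpace H] (hκ : Measurable (Function.uncurry κ))
    (hφ : IsFeatureMap κ φ) (w : H) : Measurable fun x => (inner ℝ w (φ x) : ℝ) := by
  let K : Submodule ℝ H :=
    { carrier := {w | Measurable fun x => (inner ℝ w (φ x) : ℝ)}
      zero_mem' := by simp
      add_mem' := fun {a b} (ha : Measurable _) (hb : Measurable _) => by
        simp only [Set.mem_ofPred_eq, inner_add_left]
        exact ha.add hb
      smul_mem' := fun t a (ha : Measurable _) => by
        simpa only [Set.mem_ofPred_eq, real_inner_smul_left] using ha.const_mul t }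
  have hclosed : IsClosed (K : Set H) := by
    refine IsSeqClosed.isClosed fun u a hu ha => ?_
    refine measurable_of_tendsto_metrizable hu (tendsto_pi_nhds.2 fun x => ?_)
    exact ((continuous_id.inner continuous_const).tendsto a).comp ha
  have hmem : ∀ x, φ x ∈ K := fun x => by
    change Measurable fun x' => (inner ℝ (φ x) (φ x') : ℝ)
    simp only [← hφ x]
    exact hκ.comp (measurable_const.prodMk measurable_id)
  have : CompleteSpace K := hclosed.completeSpace_coe
  have horth : Kᗮ = ⊥ := by
    refine (Submodule.eq_bot_iff _).2 fun v hv => ?_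
    have hvK : v ∈ K := by
      change Measurable fun x => (inner ℝ v (φ x) : ℝ)
      have : ∀ x, (inner ℝ v (φ x) : ℝ) = 0 := fun x => (K.mem_orthogonal' v).1 hv _ (hmem x)
      simp [this]
    exact inner_self_eq_zero.1 ((K.mem_orthogonal v).1 hv v hvK)
  have : w ∈ K := by
    rw [Submodule.orthogonal_eq_bot_iff.1 horth]
    trivial
  exact this

/-- Rescaling into the closed ball of radius `Λ`; for `Λ = 0` it is the zero map, also at `0`,
where the quotient has the value `0`. -/
noncomputable def clipBall (Λ : ℝ) (w : H) : H := (Λ / max Λ ‖w‖) • w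

lemma continuous_clipBall {Λ : ℝ} (hΛ : 0 ≤ Λ) : Continuous (clipBall Λ : H → H) := by
  rcases hΛ.eq_or_lt with rfl | hΛ
  · have : (clipBall 0 : H → H) = fun _ => 0 := funext fun w => by simp [clipBall]
    rw [this]
    exact continuous_const
  · have : ∀ w : H, max Λ ‖w‖ ≠ 0 := fun w => (hΛ.trans_le (le_max_left _ _)).ne'
    unfold clipBall
    fun_prop (disch := exact this _)

lemma norm_clipBall_le {Λ : ℝ} (hΛ : 0 ≤ Λ) (w : H) : ‖clipBall Λ w‖ ≤ Λ := by
  have hmax : 0 ≤ max Λ ‖w‖ := hΛ.trans (le_max_left _ _)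
  rw [clipBall, norm_smul, Real.norm_of_nonneg (div_nonneg hΛ hmax), div_mul_eq_mul_div]
  exact div_le_of_le_mul₀ hmax hΛ (by gcongr; exact le_max_right _ _)

lemma clipBall_eq_self {Λ : ℝ} {w : H} (hw : ‖w‖ ≤ Λ) : clipBall Λ w = w := by
  rw [clipBall, max_eq_left hw]
  rcases eq_or_ne Λ 0 with rfl | hΛ
  · rw [norm_le_zero_iff.1 hw, smul_zero]
  · rw [div_self hΛ, one_smul]

/-- A representer theorem with rational coefficients: the supremum over a ball of a continuous
function of the scalar products with finitely many vectors is a countable supremum, over clipped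
rational combinations of these vectors. -/
lemma iSup_closedBall_eq_iSup_rat {m : Type*} [Fintype m] {Λ : ℝ} (hΛ : 0 ≤ Λ)
    {G : (m → ℝ) → ℝ} (hG : Continuous G) (x : m → H) {M : ℝ}
    (hM : ∀ w : H, ‖w‖ ≤ Λ → G (fun k => inner ℝ w (x k)) ≤ M) :
    ⨆ w : Metric.closedBall (0 : H) Λ, G (fun k => inner ℝ (w : H) (x k))
      = ⨆ a : m → ℚ, G (fun k => inner ℝ (clipBall Λ (∑ l, (a l : ℝ) • x l)) (x k)) := by
  have : Nonempty (Metric.closedBall (0 : H) Λ) := ⟨⟨0, by simpa using hΛ⟩⟩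
  have hb1 : BddAbove (Set.range fun w : Metric.closedBall (0 : H) Λ =>
      G (fun k => inner ℝ (w : H) (x k))) :=
    ⟨M, by rintro _ ⟨w, rfl⟩; exact hM _ (mem_closedBall_zero_iff.1 w.2)⟩
  have hb2 : BddAbove (Set.range fun a : m → ℚ =>
      G (fun k => inner ℝ (clipBall Λ (∑ l, (a l : ℝ) • x l)) (x k))) :=
    ⟨M, by rintro _ ⟨w, rfl⟩; exact hM _ (norm_clipBall_le hΛ _)⟩
  refine le_antisymm (ciSup_le fun w => ?_) (ciSup_le fun a => ?_)
  · -- Projecting `w` onto the span changes no scalar product and does not increase the norm.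
    set V := Submodule.span ℝ (Set.range x) with hV
    have : FiniteDimensional ℝ V := FiniteDimensional.span_of_finite ℝ (Set.finite_range x)
    set v : H := V.starProjection w with hv
    have hvV : v ∈ V := V.starProjection_apply_mem w
    have hvn : ‖v‖ ≤ Λ :=
      (V.norm_starProjection_apply_le (w : H)).trans (mem_closedBall_zero_iff.1 w.2)
    have hvi : ∀ k, (inner ℝ (w : H) (x k) : ℝ) = inner ℝ v (x k) := by
      intro k
      have hx : x k ∈ V := Submodule.subset_span ⟨k, rfl⟩
      have := (V.mem_orthogonal' _).1 (V.sub_starProjection_mem_orthogonal (w : H)) (x k) hx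
      rw [inner_sub_left] at this
      linarith
    obtain ⟨a, ha⟩ := (Submodule.mem_span_range_iff_exists_fun ℝ).1 hvV
    have hcont : Continuous fun a : m → ℝ =>
        G (fun k => inner ℝ (clipBall Λ (∑ l, a l • x l)) (x k)) := by
      refine hG.comp (continuous_pi fun k => ?_)
      refine Continuous.inner ((continuous_clipBall hΛ).comp ?_) continuous_const
      fun_prop
    have hdense : DenseRange fun (q : m → ℚ) l => ((q l : ℚ) : ℝ) :=
      DenseRange.piMap fun _ => Rat.denseRange_cast
    have hall : ∀ a : m → ℝ, G (fun k => inner ℝ (clipBall Λ (∑ l, a l • x l)) (x k))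
        ≤ ⨆ a : m → ℚ, G (fun k => inner ℝ (clipBall Λ (∑ l, (a l : ℝ) • x l)) (x k)) :=
      fun a => hdense.induction_on a (isClosed_le hcont continuous_const)
        fun q => le_ciSup hb2 q
    have := hall a
    rw [ha, clipBall_eq_self hvn] at this
    simpa only [hvi] using this
  · exact le_ciSup hb1 ⟨clipBall Λ (∑ l, (a l : ℝ) • x l),
      mem_closedBall_zero_iff.2 (norm_clipBall_le hΛ _)⟩

/-- The supremum over a ball of a functional of finitely many values of the linear functional is
measurable in the sample, since it is a countable supremum of functions of kernel values. -/
lemma measurable_iSup_closedBall_featureMap {Ω m : Type*} [MeasurableSpace Ω] [Fintype m]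
    (hκ : Measurable (Function.uncurry κ)) (hφ : IsFeatureMap κ φ) {Λ : ℝ} (hΛ : 0 ≤ Λ)
    {G : Ω → (m → ℝ) → ℝ} (hG : Measurable (Function.uncurry G))
    (hGc : ∀ ω, Continuous (G ω)) {X : m → Ω → 𝒳} (hX : ∀ k, Measurable (X k)) {M : ℝ}
    (hM : ∀ ω (w : H), ‖w‖ ≤ Λ → G ω (fun k => inner ℝ w (φ (X k ω))) ≤ M) :
    Measurable fun ω => ⨆ w : Metric.closedBall (0 : H) Λ,
      G ω (fun k => inner ℝ (w : H) (φ (X k ω))) := by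
  have hκX : ∀ l k, Measurable fun ω => κ (X l ω) (X k ω) := fun l k =>
    hκ.comp ((hX l).prodMk (hX k))
  have heq : ∀ ω, (⨆ w : Metric.closedBall (0 : H) Λ, G ω (fun k => inner ℝ (w : H) (φ (X k ω))))
      = ⨆ a : m → ℚ, G ω (fun k => inner ℝ
          (clipBall Λ (∑ l, (a l : ℝ) • φ (X l ω))) (φ (X k ω))) := fun ω =>
    iSup_closedBall_eq_iSup_rat hΛ (hGc ω) (fun k => φ (X k ω)) (hM ω)
  simp only [heq]
  refine Measurable.iSup fun a => ?_
  have hlin : ∀ ω k, (inner ℝ (∑ l, (a l : ℝ) • φ (X l ω)) (φ (X k ω)) : ℝ)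
      = ∑ l, (a l : ℝ) * κ (X l ω) (X k ω) := fun ω k => by
    simp only [sum_inner, real_inner_smul_left, hφ (X _ ω) (X k ω)]
  have hnorm : ∀ ω, ‖∑ l, (a l : ℝ) • φ (X l ω)‖
      = √(∑ k, (a k : ℝ) * ∑ l, (a l : ℝ) * κ (X l ω) (X k ω)) := fun ω => by
    rw [norm_eq_sqrt_real_inner, inner_sum]
    simp only [real_inner_smul_right, hlin]
  have hclip : ∀ ω k, (inner ℝ (clipBall Λ (∑ l, (a l : ℝ) • φ (X l ω))) (φ (X k ω)) : ℝ)
      = Λ / max Λ √(∑ k, (a k : ℝ) * ∑ l, (a l : ℝ) * κ (X l ω) (X k ω))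
        * ∑ l, (a l : ℝ) * κ (X l ω) (X k ω) := fun ω k => by
    rw [clipBall, real_inner_smul_left, hnorm, hlin]
  simp only [hclip]
  refine hG.comp (measurable_id.prodMk (measurable_pi_iff.2 fun k => ?_))
  fun_prop

end Measurability

/-! ### Hamming losses -/

lemma Label.abs_coe (y : Label) : |(y : ℝ)| = 1 := by
  rcases y with ⟨y, rfl | rfl⟩ <;> simp

lemma ind_mem_Icc (p : Prop) : ind p ∈ Set.Icc (0 : ℝ) 1 := by
  unfold ind
  split_ifs <;> simp

/-- The zero score is classified as `-1`. Hence a dominating loss is at least `1` at `0`, which makes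
its bound `B` positive. -/
lemma ind_sgn_zero_ne_one : ind (sgn 0 ≠ ⟨1, by simp⟩) = 1 := by
  have : sgn 0 ≠ ⟨1, by simp⟩ := by
    rw [sgn, if_neg (lt_irrefl _), Ne, Subtype.mk.injEq]
    norm_num
  rw [ind, if_pos this]

lemma measurable_sgn : Measurable sgn :=
  Measurable.ite measurableSet_Ioi measurable_const measurable_const

lemma measurable_ind {Ω : Type*} [MeasurableSpace Ω] {p : Ω → Prop}
    (hp : MeasurableSet {ω | p ω}) : Measurable fun ω => ind (p ω) := by
  classical
  unfold ind
  exact Measurable.ite hp measurable_const measurable_const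

lemma measurable_ind_sgn_ne {Ω : Type*} [MeasurableSpace Ω] {a : Ω → ℝ} {y : Ω → Label}
    (ha : Measurable a) (hy : Measurable y) : Measurable fun ω => ind (sgn (a ω) ≠ y ω) := by
  refine measurable_ind ?_
  have h : MeasurableSet {ω | ((sgn (a ω) : Label) : ℝ) = (y ω : ℝ)} :=
    measurableSet_eq_fun (measurable_subtype_coe.comp (measurable_sgn.comp ha))
      (measurable_subtype_coe.comp hy)
  have heq : {ω | sgn (a ω) ≠ y ω} = {ω | ((sgn (a ω) : Label) : ℝ) = (y ω : ℝ)}ᶜ := by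
    ext ω
    simp [Subtype.ext_iff]
  rw [heq]
  exact h.compl

lemma lipschitzWith_hammingSurrogate {c : ℕ} {ℓ : ℝ → ℝ} {ρ : ℝ≥0}
    (hℓ : LipschitzWith ρ ℓ) (y : Fin c → Label) :
    LipschitzWith (ρ / NNReal.sqrt c)
      (fun v : EuclideanSpace ℝ (Fin c) => hammingSurrogate ℓ v y) := by
  refine LipschitzWith.of_dist_le_mul fun v v' => ?_
  have hcs : ∑ j, |v j - v' j| ≤ √c * dist v v' := by
    rw [EuclideanSpace.dist_eq]
    simp only [Real.dist_eq]
    rw [← Real.sqrt_mul (by positivity)]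
    refine Real.le_sqrt_of_sq_le ?_
    simpa using sq_sum_le_card_mul_sum_sq (s := Finset.univ) (f := fun j => |v j - v' j|)
  calc dist (hammingSurrogate ℓ v y) (hammingSurrogate ℓ v' y)
      = (1 / (c : ℝ)) * |∑ j, (ℓ ((y j : ℝ) * v j) - ℓ ((y j : ℝ) * v' j))| := by
        rw [Real.dist_eq, hammingSurrogate, hammingSurrogate, ← mul_sub, abs_mul,
          ← Finset.sum_sub_distrib, abs_of_nonneg (by positivity : (0 : ℝ) ≤ 1 / c)]
    _ ≤ (1 / (c : ℝ)) * ∑ j, ρ * |v j - v' j| := by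
        gcongr
        refine abs_sum_le_sum_of_abs_le fun j _ => ?_
        have := hℓ.dist_le_mul ((y j : ℝ) * v j) ((y j : ℝ) * v' j)
        rwa [Real.dist_eq, Real.dist_eq, ← mul_sub, abs_mul, Label.abs_coe, one_mul] at this
    _ ≤ (1 / (c : ℝ)) * (ρ * (√c * dist v v')) := by
        rw [← Finset.mul_sum]
        gcongr
    _ = (ρ / NNReal.sqrt c : ℝ≥0) * dist v v' := by
        rw [NNReal.coe_div, Real.coe_sqrt, NNReal.coe_natCast]
        rcases Nat.eq_zero_or_pos c with rfl | hc
        · simp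
        · have hc' : (0 : ℝ) < c := by exact_mod_cast hc
          have hs : √(c : ℝ) ^ 2 = c := Real.sq_sqrt hc'.le
          have hs' : √(c : ℝ) ≠ 0 := (Real.sqrt_pos.2 hc').ne'
          nth_rewrite 1 [← hs]
          field_simp

lemma norm_le_weightNorm {H : Type*} [NormedAddCommGroup H] {c : ℕ} (W : Fin c → H)
    (j : Fin c) : ‖W j‖ ≤ weightNorm W :=
  Real.le_sqrt_of_sq_le
    (Finset.single_le_sum (f := fun j => ‖W j‖ ^ 2) (fun _ _ => sq_nonneg _) (Finset.mem_univ j))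

lemma weightNorm_single {H : Type*} [NormedAddCommGroup H] {c : ℕ} (w : H)
    (j : Fin c) : weightNorm (Pi.single j w) = ‖w‖ := by
  have : ∑ i, ‖(Pi.single j w : Fin c → H) i‖ ^ 2 = ‖w‖ ^ 2 := by
    rw [Finset.sum_eq_single j (fun i _ hi => by simp [hi]) (by simp)]
    simp
  rw [weightNorm, this, Real.sqrt_sq (norm_nonneg _)]

lemma loss_inner_le {𝒳 H : Type*} [NormedAddCommGroup H] [InnerProductSpace ℝ H] {c : ℕ}
    {φ : 𝒳 → H} {Λ : ℝ} {ℓ : ℝ → ℝ} {B : ℝ}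
    (hℓ_bdd : ∀ f ∈ hypothesisSet φ c Λ, ∀ (x : 𝒳) (j : Fin c) (y : Label),
      ℓ ((y : ℝ) * f x j) ≤ B) (j : Fin c) {w : H} (hw : ‖w‖ ≤ Λ) (x : 𝒳) (y : Label) :
    ℓ ((y : ℝ) * inner ℝ w (φ x)) ≤ B := by
  have := hℓ_bdd (fun x => WithLp.toLp 2 fun i => inner ℝ ((Pi.single j w : Fin c → H) i) (φ x))
    ⟨Pi.single j w, by rwa [weightNorm_single], fun _ _ => rfl⟩ x j y
  simpa using this

lemma loss_nonneg {ℓ : ℝ → ℝ}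
    (hℓ_ge : ∀ (a : ℝ) (y : Label), ind (sgn a ≠ y) ≤ ℓ ((y : ℝ) * a)) (a : ℝ) :
    0 ≤ ℓ a := by
  have := (ind_mem_Icc _).1.trans (hℓ_ge a ⟨1, by simp⟩)
  simpa using this

section Kernel

variable {𝒳 H : Type*} [NormedAddCommGroup H] [InnerProductSpace ℝ H]
  {c n : ℕ} {κ : 𝒳 → 𝒳 → ℝ} {φ : 𝒳 → H} {Λ : ℝ}

/-- The loss of the `j`-th label, for the weight `w` of the `j`-th score. -/
def coordLoss (ℓ : ℝ → ℝ) (φ : 𝒳 → H) (Λ : ℝ) (j : Fin c)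
    (w : Metric.closedBall (0 : H) Λ) (z : 𝒳 × (Fin c → Label)) : ℝ :=
  ℓ ((z.2 j : ℝ) * inner ℝ (w : H) (φ z.1))

variable {ℓ : ℝ → ℝ} {ρ : ℝ≥0} {B : ℝ}

lemma sum_iSup_coordLoss_le (hφ : IsFeatureMap κ φ) (hΛ : 0 ≤ Λ) {r : ℝ} (hr : 0 < r)
    (hκr : ∀ x, κ x x ≤ r ^ 2) (hℓ : LipschitzWith ρ ℓ) (j : Fin c)
    (hh : ∀ w z, coordLoss ℓ φ Λ j w z ∈ Set.Icc 0 B) (S : Fin n → 𝒳 × (Fin c → Label)) :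
    ∑ σ : Fin n → Bool, ⨆ w, ∑ k, boolSign (σ k) * coordLoss ℓ φ Λ j w (S k)
      ≤ 2 ^ n * (ρ * Λ * (r * √n)) := by
  refine (sum_iSup_lipschitz_inner_le hΛ (ρ := ρ) (g := fun k a => ℓ (((S k).2 j : ℝ) * a))
    (x := fun k => φ (S k).1) (fun k => ?_) (Mg := B) fun k w => ?_).trans ?_
  · refine LipschitzWith.of_dist_le_mul fun a b => ?_
    have := hℓ.dist_le_mul (((S k).2 j : ℝ) * a) (((S k).2 j : ℝ) * b)
    rwa [Real.dist_eq (_ * a), ← mul_sub, abs_mul, Label.abs_coe, one_mul, ← Real.dist_eq] at this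
  · have hw : coordLoss ℓ φ Λ j w (S k) ∈ Set.Icc 0 B := hh w (S k)
    change |coordLoss ℓ φ Λ j w (S k)| ≤ B
    exact abs_le.2 ⟨by linarith [hw.1, hw.2], hw.2⟩
  · have hsq : ∀ x, ‖φ x‖ ^ 2 ≤ r ^ 2 := fun x => by
      rw [← real_inner_self_eq_norm_sq, ← hφ x x]
      exact hκr x
    have hsqrt : √(∑ k, ‖φ (S k).1‖ ^ 2) ≤ r * √n := by
      refine Real.sqrt_le_iff.2 ⟨by positivity, ?_⟩
      rw [mul_pow, Real.sq_sqrt (by positivity)]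
      calc ∑ k, ‖φ (S k).1‖ ^ 2 ≤ ∑ _k : Fin n, r ^ 2 := Finset.sum_le_sum fun k _ => hsq _
        _ = r ^ 2 * n := by simp [mul_comm]
    gcongr

variable [MeasurableSpace 𝒳]

lemma integrable_hammingLoss01 [CompleteSpace H] (hκ : Measurable (Function.uncurry κ))
    (hφ : IsFeatureMap κ φ) (D : Measure (𝒳 × (Fin c → Label))) [IsProbabilityMeasure D]
    {f : 𝒳 → EuclideanSpace ℝ (Fin c)} (hf : f ∈ hypothesisSet φ c Λ) :
    Integrable (fun z => hammingLoss01 (sgnClassifier f z.1) z.2) D := by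
  obtain ⟨W, -, hW⟩ := hf
  unfold hammingLoss01 sgnClassifier
  refine (integrable_finsetSum _ fun j _ => ?_).const_mul _
  simp only [hW]
  refine integrable_of_abs_le (M := 1) (measurable_ind_sgn_ne
    ((measurable_inner_featureMap hκ hφ (W j)).comp measurable_fst)
    ((measurable_pi_apply j).comp measurable_snd)) fun z => ?_
  have := ind_mem_Icc (sgn (inner ℝ (W j) (φ z.1)) ≠ z.2 j)
  exact abs_le.2 ⟨by linarith [this.1], this.2⟩

lemma measurable_ghostDeviation_coordLoss (hκ : Measurable (Function.uncurry κ))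
    (hφ : IsFeatureMap κ φ) (hΛ : 0 ≤ Λ) (hℓ : Continuous ℓ) (j : Fin c)
    (hh : ∀ w z, coordLoss ℓ φ Λ j w z ∈ Set.Icc 0 B) :
    Measurable fun p : (Fin n → 𝒳 × (Fin c → Label)) × (Fin n → 𝒳 × (Fin c → Label)) =>
      ghostDeviation (coordLoss ℓ φ Λ j) p.1 p.2 := by
  have hy : ∀ k, Measurable fun S : Fin n → 𝒳 × (Fin c → Label) => ((S k).2 j : ℝ) := fun k =>
    measurable_subtype_coe.comp
      ((measurable_pi_apply j).comp (measurable_snd.comp (measurable_pi_apply k)))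
  -- The scores at the points of the sample are indexed by `Sum.inl`, those at the points of the
  -- ghost sample by `Sum.inr`.
  let X : Fin n ⊕ Fin n →
      (Fin n → 𝒳 × (Fin c → Label)) × (Fin n → 𝒳 × (Fin c → Label)) → 𝒳 :=
    Sum.elim (fun k p => (p.1 k).1) (fun k p => (p.2 k).1)
  let G : (Fin n → 𝒳 × (Fin c → Label)) × (Fin n → 𝒳 × (Fin c → Label)) →
      (Fin n ⊕ Fin n → ℝ) → ℝ :=
    fun p s => (1 / (n : ℝ)) * ∑ k, (ℓ (((p.2 k).2 j : ℝ) * s (Sum.inr k))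
      - ℓ (((p.1 k).2 j : ℝ) * s (Sum.inl k)))
  have hG : Measurable (Function.uncurry G) := by
    refine Measurable.const_mul (Finset.measurable_fun_sum _ fun k _ => ?_) _
    refine (hℓ.measurable.comp ?_).sub (hℓ.measurable.comp ?_)
    · exact ((hy k).comp (measurable_snd.comp measurable_fst)).mul
        ((measurable_pi_apply _).comp measurable_snd)
    · exact ((hy k).comp (measurable_fst.comp measurable_fst)).mul
        ((measurable_pi_apply _).comp measurable_snd)
  have hGc : ∀ p, Continuous (G p) := fun p => by fun_prop
  have hX : ∀ k, Measurable (X k) := by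
    rintro (k | k)
    · exact measurable_fst.comp ((measurable_pi_apply k).comp measurable_fst)
    · exact measurable_fst.comp ((measurable_pi_apply k).comp measurable_snd)
  have hGM : ∀ p (w : H), ‖w‖ ≤ Λ → G p (fun k => inner ℝ w (φ (X k p)))
      ≤ (1 / (n : ℝ)) * (n * B) := fun p w hw =>
    (le_abs_self _).trans
      (abs_ghostDeviation_term_le hh p.1 p.2 ⟨w, mem_closedBall_zero_iff.2 hw⟩)
  have key := measurable_iSup_closedBall_featureMap hκ hφ hΛ hG hGc hX hGM
  exact key

/-- The one-sided uniform deviation bound. The majorant of the deviation is the average over the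
labels of the ghost deviations, integrated over the ghost sample. -/
lemma exists_event_forall_risk_le [CompleteSpace H] (hc : 0 < c) (hn : 0 < n)
    (hκ : Measurable (Function.uncurry κ)) (hφ : IsFeatureMap κ φ) (hΛ : 0 ≤ Λ) {r : ℝ}
    (hr : 0 < r) (hκr : ∀ x, κ x x ≤ r ^ 2) (D : Measure (𝒳 × (Fin c → Label)))
    [IsProbabilityMeasure D] (hℓ : LipschitzWith ρ ℓ)
    (hℓ_ge : ∀ (a : ℝ) (y : Label), ind (sgn a ≠ y) ≤ ℓ ((y : ℝ) * a)) (hB : 0 < B)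
    (hℓ_le : ∀ w : H, ‖w‖ ≤ Λ → ∀ (x : 𝒳) (y : Label), ℓ ((y : ℝ) * inner ℝ w (φ x)) ≤ B)
    {ε : ℝ} (hε : 0 ≤ ε) :
    ∃ E : Set (Fin n → 𝒳 × (Fin c → Label)), MeasurableSet E ∧
      1 - Real.exp (-(2 * n * ε ^ 2 / B ^ 2)) ≤ (Measure.pi fun _ : Fin n => D).real E ∧
      ∀ S ∈ E, ∀ f ∈ hypothesisSet φ c Λ,
        hammingRisk01 D (sgnClassifier f)
          ≤ empiricalHammingRisk ℓ S f + 2 * (ρ * Λ * (r * √n)) / n + ε := by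
  have hc' : (0 : ℝ) < c := by exact_mod_cast hc
  have hn' : (0 : ℝ) < n := by exact_mod_cast hn
  have : Nonempty (Metric.closedBall (0 : H) Λ) := ⟨⟨0, by simpa using hΛ⟩⟩
  set P := Measure.pi (fun _ : Fin n => D) with hP
  have hh : ∀ (j : Fin c) w z, coordLoss ℓ φ Λ j w z ∈ Set.Icc 0 B := fun j w z =>
    ⟨loss_nonneg hℓ_ge _, hℓ_le _ (mem_closedBall_zero_iff.1 w.2) _ _⟩
  have hhm : ∀ (j : Fin c) w, Measurable (coordLoss ℓ φ Λ j w) := fun j w => by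
    refine hℓ.continuous.measurable.comp ?_
    exact (measurable_subtype_coe.comp ((measurable_pi_apply j).comp measurable_snd)).mul
      ((measurable_inner_featureMap hκ hφ (w : H)).comp measurable_fst)
  have hgm : ∀ j : Fin c, Measurable fun p : (Fin n → 𝒳 × (Fin c → Label)) ×
      (Fin n → 𝒳 × (Fin c → Label)) => ghostDeviation (coordLoss ℓ φ Λ j) p.1 p.2 := fun j =>
    measurable_ghostDeviation_coordLoss hκ hφ hΛ hℓ.continuous j (hh j)
  have hgS : ∀ (j : Fin c) (S : Fin n → 𝒳 × (Fin c → Label)),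
      Integrable (fun S' => ghostDeviation (coordLoss ℓ φ Λ j) S S') P := fun j S => by
    have := (hgm j).comp (measurable_prodMk_left (x := S))
    exact integrable_of_abs_le this fun S' => abs_ghostDeviation_le (hh j) S S'
  set ψ : Fin c → (Fin n → 𝒳 × (Fin c → Label)) → ℝ :=
    fun j S => ∫ S', ghostDeviation (coordLoss ℓ φ Λ j) S S' ∂P with hψ
  have hψm : ∀ j, Measurable (ψ j) := fun j =>
    ((hgm j).stronglyMeasurable.integral_prod_right' (ν := P)).measurable
  have hψM : ∀ j S, |ψ j S| ≤ (1 / (n : ℝ)) * (n * B) := fun j S =>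
    abs_integral_le_of_abs_le fun S' => abs_ghostDeviation_le (hh j) S S'
  have hψd : ∀ j S k z, |ψ j (Function.update S k z) - ψ j S| ≤ B / n := fun j S k z => by
    simp only [hψ]
    rw [← integral_sub (hgS _ _) (hgS _ _)]
    exact abs_integral_le_of_abs_le fun S' => abs_ghostDeviation_update_sub_le (hh j) S S' k z
  have havg : ∀ (v : Fin c → ℝ) (M : ℝ), (∀ j, |v j| ≤ M) → |(1 / (c : ℝ)) * ∑ j, v j| ≤ M := by
    intro v M hv
    rw [abs_mul, abs_of_pos (by positivity : (0 : ℝ) < 1 / c), one_div, inv_mul_le_iff₀ hc']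
    exact (abs_sum_le_sum_of_abs_le fun j _ => hv j).trans (by simp)
  set g : (Fin n → 𝒳 × (Fin c → Label)) → ℝ := fun S => (1 / (c : ℝ)) * ∑ j, ψ j S with hg
  have hgmeas : Measurable g :=
    Measurable.const_mul (Finset.measurable_fun_sum _ fun j _ => hψm j) _
  have hgM : ∀ S, |g S| ≤ (1 / (n : ℝ)) * (n * B) := fun S => havg _ _ fun j => hψM j S
  have hgd : ∀ S k z, |g (Function.update S k z) - g S| ≤ B / n := fun S k z => by
    simp only [hg]
    rw [← mul_sub, ← Finset.sum_sub_distrib]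
    exact havg _ _ fun j => hψd j S k z
  have hmean : ∫ S, g S ∂P ≤ 2 * (ρ * Λ * (r * √n)) / n := by
    simp only [hg]
    rw [integral_const_mul, integral_finsetSum _ fun j _ =>
      integrable_of_abs_le (hψm j) (hψM j), one_div, inv_mul_le_iff₀ hc']
    calc ∑ j, ∫ S, ψ j S ∂P ≤ ∑ _j : Fin c, 2 * (ρ * Λ * (r * √n)) / n :=
          Finset.sum_le_sum fun j _ => integral_ghostDeviation_le D (hh j) (hgm j)
            (sum_iSup_coordLoss_le hφ hΛ hr hκr hℓ j (hh j))
      _ = c * (2 * (ρ * Λ * (r * √n)) / n) := by simp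
  have hmc := measure_ge_le_of_bounded_differences D hn (div_pos hB hn') hgmeas hgM hgd hε
  have hEm : MeasurableSet {S | ε ≤ g S - ∫ S', g S' ∂P} :=
    measurableSet_le measurable_const (hgmeas.sub_const _)
  refine ⟨{S | ε ≤ g S - ∫ S', g S' ∂P}ᶜ, hEm.compl, ?_, ?_⟩
  · rw [probReal_compl_eq_one_sub hEm]
    have hexp : 2 * n * ε ^ 2 / B ^ 2 = 2 * ε ^ 2 / (n * (B / n) ^ 2) := by
      field_simp
    rw [hexp]
    linarith
  · rintro S hS f ⟨W, hW, hf⟩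
    have hSg : g S - ∫ S', g S' ∂P < ε := not_le.1 hS
    set w : Fin c → Metric.closedBall (0 : H) Λ := fun j =>
      ⟨W j, mem_closedBall_zero_iff.2 ((norm_le_weightNorm W j).trans hW)⟩ with hw
    have hcoord : ∀ j z, coordLoss ℓ φ Λ j (w j) z = ℓ ((z.2 j : ℝ) * f z.1 j) := fun j z => by
      rw [hf]
      rfl
    have hcoordI : ∀ j, Integrable (coordLoss ℓ φ Λ j (w j)) D := fun j =>
      integrable_of_abs_le (M := B) (hhm j _) fun z =>
        abs_le.2 ⟨by linarith [(hh j (w j) z).1], (hh j (w j) z).2⟩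
    have hrisk : hammingRisk01 D (sgnClassifier f)
        ≤ (1 / (c : ℝ)) * ∑ j, ∫ z, coordLoss ℓ φ Λ j (w j) z ∂D := by
      rw [← integral_finsetSum _ fun j _ => hcoordI j, ← integral_const_mul]
      refine integral_mono (integrable_hammingLoss01 hκ hφ D ⟨W, hW, hf⟩)
        ((integrable_finsetSum _ fun j _ => hcoordI j).const_mul _) fun z => ?_
      refine mul_le_mul_of_nonneg_left (Finset.sum_le_sum fun j _ => ?_) (by positivity)
      rw [hcoord]
      exact hℓ_ge _ _
    have hemp : empiricalHammingRisk ℓ S f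
        = (1 / (c : ℝ)) * ∑ j, (1 / (n : ℝ)) * ∑ k, coordLoss ℓ φ Λ j (w j) (S k) := by
      simp only [empiricalHammingRisk, hammingSurrogate, hcoord, ← Finset.mul_sum]
      rw [Finset.sum_comm]
      ring
    have hdev : (1 / (c : ℝ)) * ∑ j, ∫ z, coordLoss ℓ φ Λ j (w j) z ∂D
        - empiricalHammingRisk ℓ S f ≤ g S := by
      rw [hemp, ← mul_sub, ← Finset.sum_sub_distrib]
      refine mul_le_mul_of_nonneg_left (Finset.sum_le_sum fun j _ => ?_) (by positivity)
      exact integral_sub_mean_le_integral_ghostDeviation D hn (hh j) (hhm j) (hgm j) S (w j)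
    linarith

end Kernel

/-! ### The generalization bound -/

theorem theorem2 {d c n : ℕ} (hc : 0 < c) (hn : 0 < n)
    (X : Set (EuclideanSpace ℝ (Fin d)))
    {H : Type*} [NormedAddCommGroup H] [InnerProductSpace ℝ H] [CompleteSpace H]
    (κ : X → X → ℝ) (hκ : IsPSDKernel κ) (hκ_meas : Measurable (Function.uncurry κ))
    (φ : X → H) (hφ : IsFeatureMap κ φ)
    (Λ r : ℝ) (hr : 0 < r) (hκr : ∀ x, κ x x ≤ r ^ 2)
    (D : Measure (X × (Fin c → Label))) [IsProbabilityMeasure D]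
    (ℓ : ℝ → ℝ) (ρ : ℝ≥0) (B : ℝ)
    (hℓ_lip : LipschitzWith ρ ℓ)
    (hℓ_ge : ∀ (a : ℝ) (y : Label), ind (sgn a ≠ y) ≤ ℓ ((y : ℝ) * a))
    (hℓ_bdd : ∀ f ∈ hypothesisSet φ c Λ, ∀ (x : X) (j : Fin c) (y : Label),
      ℓ ((y : ℝ) * f x j) ≤ B) :
    (∀ y : Fin c → Label, LipschitzWith (ρ / NNReal.sqrt c)
      (fun v : EuclideanSpace ℝ (Fin c) => hammingSurrogate ℓ v y)) ∧
    (∀ f ∈ hypothesisSet φ c Λ,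
      Integrable (fun z => hammingLoss01 (sgnClassifier f z.1) z.2) D) ∧
    ∀ δ : ℝ, 0 < δ →
      ∃ E : Set (Fin n → X × (Fin c → Label)),
        MeasurableSet E ∧
        1 - δ ≤ (Measure.pi (fun _ : Fin n => D)).real E ∧
        ∀ S ∈ E, ∀ f ∈ hypothesisSet φ c Λ,
          hammingRisk01 D (sgnClassifier f) ≤
            empiricalHammingRisk ℓ S f
              + 2 * Real.sqrt 2 * ρ * Real.sqrt (Λ ^ 2 * r ^ 2 / n)
              + 3 * B * Real.sqrt (Real.log (2 / δ) / (2 * n)) := by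
  refine ⟨lipschitzWith_hammingSurrogate hℓ_lip,
    fun f hf => integrable_hammingLoss01 hκ_meas hφ D hf, fun δ hδ => ?_⟩
  -- For `δ ≥ 1` the empty event has the required probability.
  rcases le_or_gt 1 δ with hδ1 | hδ1
  · exact ⟨∅, MeasurableSet.empty, by simpa using hδ1, fun S hS => absurd hS (Set.notMem_empty S)⟩
  -- For `Λ < 0` the hypothesis set is empty, since `weightNorm` is nonnegative.
  rcases lt_or_ge Λ 0 with hΛ | hΛ
  · refine ⟨Set.univ, MeasurableSet.univ, by simpa using hδ.le, fun S _ f hf => ?_⟩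
    obtain ⟨W, hW, -⟩ := hf
    exact absurd hW (not_le.2 (hΛ.trans_le (Real.sqrt_nonneg _)))
  have hn' : (0 : ℝ) < n := by exact_mod_cast hn
  have hℓ_le : ∀ w : H, ‖w‖ ≤ Λ → ∀ (x : X) (y : Label), ℓ ((y : ℝ) * inner ℝ w (φ x)) ≤ B :=
    fun w hw x y => loss_inner_le hℓ_bdd ⟨0, hc⟩ hw x y
  have hB : 0 < B := by
    obtain ⟨z⟩ : Nonempty (X × (Fin c → Label)) := nonempty_of_isProbabilityMeasure D
    have h1 := hℓ_ge 0 ⟨1, by simp⟩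
    have h2 := hℓ_le 0 (by simpa using hΛ) z.1 ⟨1, by simp⟩
    rw [ind_sgn_zero_ne_one] at h1
    rw [inner_zero_left] at h2
    exact zero_lt_one.trans_le (h1.trans h2)
  have hlog : 0 < Real.log (2 / δ) := Real.log_pos (by rw [lt_div_iff₀ hδ]; linarith)
  set ε : ℝ := 3 * B * Real.sqrt (Real.log (2 / δ) / (2 * n)) with hε
  obtain ⟨E, hEm, hEp, hE⟩ := exists_event_forall_risk_le hc hn hκ_meas hφ hΛ hr hκr D hℓ_lip
    hℓ_ge hB hℓ_le (ε := ε) (by positivity)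
  refine ⟨E, hEm, le_trans ?_ hEp, fun S hS f hf => (hE S hS f hf).trans ?_⟩
  · have hexp : 2 * n * ε ^ 2 / B ^ 2 = 9 * Real.log (2 / δ) := by
      rw [hε, mul_pow, Real.sq_sqrt (by positivity)]
      field_simp
      ring
    -- The exponential is `(δ / 2) ^ 9`.
    have hle : Real.exp (-(9 * Real.log (2 / δ))) ≤ δ := by
      rw [← Real.le_log_iff_exp_le hδ]
      have : Real.log (2 / δ) = Real.log 2 - Real.log δ := Real.log_div two_ne_zero hδ.ne'
      have := Real.log_pos (one_lt_two : (1 : ℝ) < 2)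
      linarith
    rw [hexp]
    linarith
  · have hsqrt : Real.sqrt (Λ ^ 2 * r ^ 2 / n) = Λ * r / √n := by
      rw [← mul_pow, Real.sqrt_div (by positivity), Real.sqrt_sq (by positivity)]
    have hterm : 2 * (ρ * Λ * (r * √n)) / n = 2 * ρ * (Λ * r / √n) := by
      have hs : √(n : ℝ) ^ 2 = n := Real.sq_sqrt hn'.le
      have hs' : √(n : ℝ) ≠ 0 := (Real.sqrt_pos.2 hn').ne'
      nth_rewrite 2 [← hs]
      field_simp
    have h2 : (1 : ℝ) ≤ √2 := Real.one_le_sqrt.2 one_le_two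
    have hnn : 0 ≤ 2 * (ρ : ℝ) * (Λ * r / √n) := by positivity
    rw [hsqrt, hterm]
    have := mul_le_mul_of_nonneg_right h2 hnn
    linarith
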